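/- Let $d\in\{1,3\}$ and $1<p\le\infty$. For open $\Omega\subset\mathbb R^d$ and $f\ge 0$ measurable write $\|f\|_{L^p(\Omega)}=\left(\int_\Omega f^p\,dx\right)^{1/p}$ if $p<\infty$ and $\|f\|_{L^\infty(\Omega)}=\operatorname{ess\,sup}_\Omega f$; thus $\||u|^2\|_{L^p(\Omega)}=\left(\int_\Omega|u|^{2p}\,dx\right)^{1/p}$ for $p<\infty$. Then there are constants $D_1,D_2>0$, depending only on $d$ and $p$, such that for every complex-valued $u\in C_0^\infty(\mathbb R^d\setminus\{0\})$ (smooth, with compact support in $\mathbb R^d\setminus\{0\}$) the following holds. (i) If $d=1$, then $$\big\||u|^2\big\|_{L^p(\Omega)}\le\int_\Omega\left(|u''(x)|^2-D_1\frac{|u(x)|^2}{x^4}+D_2|u(x)|^2\right)dx$$ both for $\Omega=(0,\infty)$ and for $\Omega=\mathbb R$. (ii) If $d=3$, then $$\big\||u|^2\big\|_{L^p(\mathbb R^3)}\le\int_{\mathbb R^3}\left(|\Delta u(x)|^2-D_1\frac{|u(x)|^2}{|x|^4}+D_2|u(x)|^2\right)dx .$$ -/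

import Mathlib

open MeasureTheory Set
open scoped ENNReal ContDiff Laplacian

/-- `u ∈ C₀^∞(E ∖ {0})`, where a function on `E ∖ {0}` with compact support in `E ∖ {0}` is
identified with its extension by zero to `E`: `u` is smooth, and its (closed) support is a compact
set that does not contain the origin. -/
def IsTestFunctionOffZero {E : Type*} [NormedAddCommGroup E] [NormedSpace ℝ E] (u : E → ℂ) :
    Prop :=
  ContDiff ℝ ∞ u ∧ HasCompactSupport u ∧ (0 : E) ∉ tsupport u

/-!
Let `d = dim E`, and let `D₁` be smaller than the constant of Rellich's inequality
`((d - 2) (d - 4) / 4)² ∫ |u|² / |x|⁴ ≤ ∫ |Δu|²`, so that a fraction `ε ∫ |Δu|²` of the energy is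
left after the singular term has been subtracted. Rellich's inequality is Hardy's inequality for
`u`, followed by Hardy's inequality for each `∂ᵢu`, because `∑ ∫ |∂ᵢ∂ⱼu|² = ∫ |Δu|²`. For `d < 4`
the weight `(a |ξ|⁴ + C)⁻¹` is integrable and its integral tends to zero as `C → ∞`, so on the
Fourier side Cauchy–Schwarz gives `sup |u|² ≤ ε ∫ |Δu|² + C ∫ |u|²`. With `C + 1` in place of `C`
the right-hand side dominates `∫ |u|²` as well, hence every `L^p` norm of `|u|²`. If the boundary
of `Ω` is contained in `{0}`, then `u` cut off to `Ω` is again a test function, which reduces `Ω`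
to the whole space.
-/

open Filter Module Topology

section Interpolation

variable {α : Type*} [MeasurableSpace α] {μ : Measure α}

theorem eLpNorm_le_of_enorm_le_of_lintegral_enorm_le {F : Type*} [NormedAddCommGroup F]
    {f : α → F} {p M : ℝ≥0∞} (hp : 1 ≤ p) (hf : ∀ᵐ x ∂μ, ‖f x‖ₑ ≤ M)
    (hint : ∫⁻ x, ‖f x‖ₑ ∂μ ≤ M) : eLpNorm f p μ ≤ M := by
  rcases eq_or_ne M ∞ with rfl | hM
  · exact le_top
  rcases eq_or_ne p ∞ with rfl | hp_top
  · rw [eLpNorm_exponent_top]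
    exact essSup_le_of_ae_le _ hf
  have hp_one : 1 ≤ p.toReal := by
    simpa using (ENNReal.toReal_le_toReal ENNReal.one_ne_top hp_top).2 hp
  have rpow_eq_mul (y : ℝ≥0∞) : y ^ p.toReal = y ^ (p.toReal - 1) * y := by
    conv_lhs => rw [← sub_add_cancel p.toReal 1]
    rw [ENNReal.rpow_add_of_nonneg _ _ (by linarith) zero_le_one, ENNReal.rpow_one]
  rw [eLpNorm_eq_lintegral_rpow_enorm_toReal (zero_lt_one.trans_le hp).ne' hp_top, one_div,
    ENNReal.rpow_inv_le_iff (by linarith)]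
  calc ∫⁻ x, ‖f x‖ₑ ^ p.toReal ∂μ
      ≤ ∫⁻ x, M ^ (p.toReal - 1) * ‖f x‖ₑ ∂μ := by
        refine lintegral_mono_ae (hf.mono fun x hx => ?_)
        rw [rpow_eq_mul]
        gcongr
    _ = M ^ (p.toReal - 1) * ∫⁻ x, ‖f x‖ₑ ∂μ :=
        lintegral_const_mul' _ _ (ENNReal.rpow_ne_top_of_nonneg (by linarith) hM)
    _ ≤ M ^ (p.toReal - 1) * M := by gcongr
    _ = M ^ p.toReal := (rpow_eq_mul M).symm

theorem sq_integral_le_integral_inv_mul_integral_mul_sq {w g : α → ℝ} (hw : ∀ x, 0 < w x)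
    (hw_inv : Integrable (fun x => (w x)⁻¹) μ) (hg : Integrable g μ)
    (hwg : Integrable (fun x => w x * g x ^ 2) μ) :
    (∫ x, g x ∂μ) ^ 2 ≤ (∫ x, (w x)⁻¹ ∂μ) * ∫ x, w x * g x ^ 2 ∂μ := by
  have quadratic_nonneg (t : ℝ) : 0 ≤ (∫ x, (w x)⁻¹ ∂μ) * (t * t) + (-2 * ∫ x, g x ∂μ) * t +
      ∫ x, w x * g x ^ 2 ∂μ := calc
    0 ≤ ∫ x, (w x)⁻¹ * (t - w x * g x) ^ 2 ∂μ :=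
      integral_nonneg fun x => mul_nonneg (inv_nonneg.2 (hw x).le) (sq_nonneg _)
    _ = ∫ x, ((w x)⁻¹ * (t * t) + g x * (-2 * t) + w x * g x ^ 2) ∂μ := by
      congr 1 with x
      have := (hw x).ne'
      field_simp
      ring
    _ = _ := by
      rw [integral_add ((hw_inv.mul_const _).fun_add (hg.mul_const _)) hwg,
        integral_add (hw_inv.mul_const _) (hg.mul_const _), integral_mul_const, integral_mul_const]
      ring
  have := discrim_le_zero quadratic_nonneg
  rw [discrim] at this
  linarith

end Interpolation

section PowerWeights

variable {E : Type*} [NormedAddCommGroup E] [NormedSpace ℝ E] [FiniteDimensional ℝ E]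
  [MeasurableSpace E] [BorelSpace E] (μ : Measure E) [μ.IsAddHaarMeasure]

theorem integrable_inv_mul_norm_pow_add {n : ℕ} (hn : finrank ℝ E < n) {a C : ℝ} (ha : 0 < a)
    (hC : 0 < C) : Integrable (fun x : E => (a * ‖x‖ ^ n + C)⁻¹) μ := by
  have : 0 < min a C := lt_min ha hC
  refine ((integrable_one_add_norm (μ := μ) (r := n) (by exact_mod_cast hn)).const_mul
    (2 ^ (n - 1) / min a C)).mono' ?_ (.of_forall fun x => ?_)
  · exact (Continuous.inv₀ (by fun_prop) fun x => by positivity).aestronglyMeasurable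
  have key : min a C * (1 + ‖x‖) ^ n ≤ 2 ^ (n - 1) * (a * ‖x‖ ^ n + C) := calc
    min a C * (1 + ‖x‖) ^ n ≤ min a C * (2 ^ (n - 1) * (1 ^ n + ‖x‖ ^ n)) := by
      gcongr
      exact add_pow_le zero_le_one (norm_nonneg x) n
    _ = 2 ^ (n - 1) * (min a C * ‖x‖ ^ n + min a C) := by ring
    _ ≤ 2 ^ (n - 1) * (a * ‖x‖ ^ n + C) := by
      gcongr
      exacts [min_le_left a C, min_le_right a C]
  rw [Real.rpow_neg (by positivity), Real.rpow_natCast, Real.norm_of_nonneg (by positivity),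
    ← div_eq_mul_inv, div_div, inv_eq_one_div, div_le_div_iff₀ (by positivity) (by positivity)]
  linarith

theorem tendsto_integral_inv_mul_norm_pow_add_atTop {n : ℕ} (hn : finrank ℝ E < n) {a : ℝ}
    (ha : 0 < a) :
    Tendsto (fun C : ℝ => ∫ x : E, (a * ‖x‖ ^ n + C)⁻¹ ∂μ) atTop (𝓝 0) := by
  rw [← integral_zero E ℝ (μ := μ)]
  refine tendsto_integral_filter_of_dominated_convergence _ ?_ ?_
    (integrable_inv_mul_norm_pow_add μ hn ha one_pos) (.of_forall fun x => ?_)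
  · filter_upwards [eventually_gt_atTop 0] with C hC
    exact (integrable_inv_mul_norm_pow_add μ hn ha hC).aestronglyMeasurable
  · filter_upwards [eventually_ge_atTop 1] with C hC
    refine .of_forall fun x => ?_
    rw [Real.norm_of_nonneg (by positivity)]
    gcongr
  · exact (tendsto_atTop_add_const_left _ _ tendsto_id).inv_tendsto_atTop

variable {F : Type*} [NormedAddCommGroup F] [NormedSpace ℝ F]

theorem integral_fderiv_apply_self {v : E → F} (hv : ContDiff ℝ 1 v) (hc : HasCompactSupport v) :
    ∫ x, fderiv ℝ v x x ∂μ = -((finrank ℝ E : ℝ) • ∫ x, v x ∂μ) := by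
  let b := finBasis ℝ E
  let c (i) : E →L[ℝ] ℝ := (b.coord i).toContinuousLinearMap
  have hcb (i) : c i (b i) = 1 := by simp [c]
  have hexpand (x : E) : fderiv ℝ v x x = ∑ i, c i x • fderiv ℝ v x (b i) := by
    conv_lhs => rw [← b.sum_repr x, map_sum]
    simp [c]
  have hint (i) : Integrable (fun x => c i x • fderiv ℝ v x (b i)) μ :=
    ((c i).continuous.smul ((hv.continuous_fderiv one_ne_zero).clm_apply
      continuous_const)).integrable_of_hasCompactSupport (hc.fderiv_apply ℝ (b i)).smul_left
  have hparts (i) : ∫ x, c i x • fderiv ℝ v x (b i) ∂μ = -∫ x, v x ∂μ := by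
    have h := integral_smul_fderiv_eq_neg_fderiv_smul_of_integrable (μ := μ) (f := c i) (g := v)
      (v := b i)
      (by simpa [hcb] using hv.continuous.integrable_of_hasCompactSupport hc) (hint i)
      (((c i).continuous.smul hv.continuous).integrable_of_hasCompactSupport hc.smul_left)
      (fun x _ => (c i).differentiableAt) (fun x _ => hv.differentiable one_ne_zero x)
    simpa [hcb] using h
  simp_rw [hexpand]
  rw [integral_finsetSum _ fun i _ => hint i]
  simp [hparts, ← Nat.cast_smul_eq_nsmul ℝ]

end PowerWeights

section Sobolev

open SchwartzMap FourierTransform Real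
open scoped LineDeriv

theorem integrable_norm_sq_schwartz {E F : Type*} [NormedAddCommGroup E] [NormedSpace ℝ E]
    [MeasurableSpace E] [BorelSpace E] [SecondCountableTopology E] [NormedAddCommGroup F]
    [NormedSpace ℝ F] (μ : Measure E) [μ.HasTemperateGrowth] (f : 𝓢(E, F)) :
    Integrable (fun x => ‖f x‖ ^ 2) μ :=
  (memLp_two_iff_integrable_sq_norm f.continuous.aestronglyMeasurable).1 (f.memLp 2 μ)

variable {E F : Type*} [NormedAddCommGroup E] [InnerProductSpace ℝ E] [FiniteDimensional ℝ E]
  [MeasurableSpace E] [BorelSpace E]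

section NormedSpace

variable [NormedAddCommGroup F] [NormedSpace ℂ F]

theorem norm_fourier_lineDeriv (f : 𝓢(E, F)) (v ξ : E) :
    ‖𝓕 (∂_{v} f) ξ‖ = 2 * π * |inner ℝ ξ v| * ‖𝓕 f ξ‖ := by
  rw [fourier_lineDerivOp_eq, _root_.smul_apply, smulLeftCLM_apply_apply (by fun_prop)]
  simp [norm_smul, mul_assoc, abs_of_pos pi_pos]

variable [CompleteSpace F]

theorem norm_fourier_laplacian (f : 𝓢(E, F)) (ξ : E) :
    ‖𝓕 (Δ f) ξ‖ = (2 * π) ^ 2 * ‖ξ‖ ^ 2 * ‖𝓕 f ξ‖ := by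
  rw [laplacian_eq_fourierMultiplierCLM, fourierMultiplierCLM_apply, FourierTransform.fourier_smul,
    FourierTransform.fourier_fourierInv_eq, _root_.smul_apply,
    smulLeftCLM_apply_apply (by fun_prop)]
  simp [norm_smul, mul_assoc, abs_of_pos pi_pos]

theorem sum_norm_sq_fourier_lineDeriv_lineDeriv {ι : Type*} [Fintype ι]
    (b : OrthonormalBasis ι ℝ E) (f : 𝓢(E, F)) (ξ : E) :
    ∑ i, ∑ j, ‖𝓕 (∂_{b j} (∂_{b i} f)) ξ‖ ^ 2 = ‖𝓕 (Δ f) ξ‖ ^ 2 := by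
  simp_rw [norm_fourier_lineDeriv, norm_fourier_laplacian, mul_pow, sq_abs, ← Finset.sum_mul,
    ← Finset.mul_sum, b.sum_sq_inner_left, ← Finset.sum_mul, ← Finset.mul_sum, b.sum_sq_inner_left]
  ring

theorem norm_apply_le_integral_norm_fourier (f : 𝓢(E, F)) (x : E) : ‖f x‖ ≤ ∫ ξ, ‖𝓕 f ξ‖ := by
  have h : f x = ∫ ξ, 𝐞 (inner ℝ ξ x) • 𝓕 f ξ := by
    conv_lhs => rw [← FourierTransform.fourierInv_fourier_eq (F := 𝓢(E, F)) f]
    rw [fourierInv_coe, Real.fourierInv_eq]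
  simpa [h] using norm_integral_le_integral_norm fun ξ => 𝐞 (inner ℝ ξ x) • 𝓕 f ξ

end NormedSpace

variable [NormedAddCommGroup F] [InnerProductSpace ℂ F] [CompleteSpace F]

theorem sum_integral_norm_sq_lineDeriv_lineDeriv {ι : Type*} [Fintype ι]
    (b : OrthonormalBasis ι ℝ E) (f : 𝓢(E, F)) :
    ∑ i, ∑ j, ∫ x, ‖∂_{b j} (∂_{b i} f) x‖ ^ 2 = ∫ x, ‖(Δ f : 𝓢(E, F)) x‖ ^ 2 := by
  have hint (i j : ι) : Integrable fun ξ => ‖𝓕 (∂_{b j} (∂_{b i} f)) ξ‖ ^ 2 :=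
    integrable_norm_sq_schwartz volume _
  rw [← integral_norm_sq_fourier (Δ f : 𝓢(E, F))]
  simp_rw [← sum_norm_sq_fourier_lineDeriv_lineDeriv b]
  rw [integral_finsetSum _ fun i _ => integrable_finsetSum _ fun j _ => hint i j]
  simp_rw [integral_finsetSum _ fun j _ => hint _ j, integral_norm_sq_fourier]

theorem exists_norm_sq_le_integral_laplacian (hE : finrank ℝ E < 4) {ε : ℝ} (hε : 0 < ε) :
    ∃ C : ℝ, 0 < C ∧ ∀ (f : 𝓢(E, F)) (x : E),
      ‖f x‖ ^ 2 ≤ ε * (∫ y, ‖(Δ f : 𝓢(E, F)) y‖ ^ 2) + C * ∫ y, ‖f y‖ ^ 2 := by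
  have ha : 0 < ε * (2 * π) ^ 4 := by positivity
  obtain ⟨C, hC_le, hC⟩ :=
    (((tendsto_integral_inv_mul_norm_pow_add_atTop volume hE ha).eventually_le_const
      zero_lt_one).and (eventually_gt_atTop 0)).exists
  refine ⟨C, hC, fun f x => ?_⟩
  set w : E → ℝ := fun ξ => ε * (2 * π) ^ 4 * ‖ξ‖ ^ 4 + C
  have hw (ξ : E) : 0 < w ξ := by positivity
  have hw_mul (ξ : E) :
      w ξ * ‖𝓕 f ξ‖ ^ 2 = ε * ‖𝓕 (Δ f) ξ‖ ^ 2 + C * ‖𝓕 f ξ‖ ^ 2 := by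
    rw [norm_fourier_laplacian]
    ring
  have hΔ := (integrable_norm_sq_schwartz volume (𝓕 (Δ f))).const_mul ε
  have hf := (integrable_norm_sq_schwartz volume (𝓕 f)).const_mul C
  calc ‖f x‖ ^ 2
      ≤ (∫ ξ, ‖𝓕 f ξ‖) ^ 2 := by
        gcongr
        exact norm_apply_le_integral_norm_fourier f x
    _ ≤ (∫ ξ, (w ξ)⁻¹) * ∫ ξ, w ξ * ‖𝓕 f ξ‖ ^ 2 :=
        sq_integral_le_integral_inv_mul_integral_mul_sq hw
          (integrable_inv_mul_norm_pow_add volume hE ha hC) (𝓕 f).integrable.norm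
          (by simpa only [hw_mul] using hΔ.fun_add hf)
    _ ≤ ∫ ξ, w ξ * ‖𝓕 f ξ‖ ^ 2 :=
        mul_le_of_le_one_left (integral_nonneg fun ξ => by positivity [hw ξ]) hC_le
    _ = ε * (∫ y, ‖(Δ f : 𝓢(E, F)) y‖ ^ 2) + C * ∫ y, ‖f y‖ ^ 2 := by
        simp_rw [hw_mul]
        rw [integral_add hΔ hf, integral_const_mul, integral_const_mul, integral_norm_sq_fourier,
          integral_norm_sq_fourier]

end Sobolev

section Indicator

variable {X : Type*} [TopologicalSpace X] {Ω : Set X} {a x : X}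

theorem measurableSet_of_countable_frontier [MeasurableSpace X] [OpensMeasurableSpace X]
    [T1Space X] (hΩ : (frontier Ω).Countable) : MeasurableSet Ω := by
  rw [← union_sdiff_cancel (interior_subset (s := Ω))]
  exact isOpen_interior.measurableSet.union
    (hΩ.mono (sdiff_subset_sdiff_left subset_closure)).measurableSet

variable {M : Type*} [Zero M] {u : X → M}

theorem indicator_eventuallyEq_self_of_mem (hΩ : frontier Ω ⊆ {a}) (hu : u =ᶠ[𝓝 a] 0)
    (hx : x ∈ Ω) : Ω.indicator u =ᶠ[𝓝 x] u := by
  rcases eq_or_ne x a with rfl | hxa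
  · filter_upwards [hu] with y hy
    simp [hy]
  · have hx_int : x ∈ interior Ω := by
      by_contra h
      exact hxa (hΩ ⟨subset_closure hx, h⟩)
    filter_upwards [mem_interior_iff_mem_nhds.1 hx_int] with y hy
    exact indicator_of_mem hy u

theorem indicator_eventuallyEq_zero_of_notMem (hΩ : frontier Ω ⊆ {a}) (hu : u =ᶠ[𝓝 a] 0)
    (hx : x ∉ Ω) : Ω.indicator u =ᶠ[𝓝 x] 0 := by
  rw [← frontier_compl] at hΩ
  filter_upwards [indicator_eventuallyEq_self_of_mem hΩ hu hx] with y hy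
  by_cases hyΩ : y ∈ Ω
  · simp_all
  · simp [hyΩ]

end Indicator

section TestFunctions

variable {E : Type*} [NormedAddCommGroup E] [NormedSpace ℝ E] {u : E → ℂ}

namespace IsTestFunctionOffZero

theorem eventuallyEq_zero (hu : IsTestFunctionOffZero u) : u =ᶠ[𝓝 0] 0 :=
  notMem_tsupport_iff_eventuallyEq.1 hu.2.2

theorem apply_zero (hu : IsTestFunctionOffZero u) : u 0 = 0 :=
  hu.eventuallyEq_zero.self_of_nhds

theorem fderiv_apply (hu : IsTestFunctionOffZero u) {V : E → E} (hV : ContDiff ℝ ∞ V) :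
    IsTestFunctionOffZero fun x => fderiv ℝ u x (V x) := by
  have hsupp : Function.support (fun x => fderiv ℝ u x (V x)) ⊆ tsupport u :=
    fun x hx => support_fderiv_subset ℝ fun h => hx (by simp [h])
  exact ⟨(hu.1.fderiv_right (m := ∞) (by simp)).clm_apply hV, hu.2.1.mono' hsupp,
    fun h => hu.2.2 (closure_minimal hsupp (isClosed_tsupport u) h)⟩

theorem indicator {Ω : Set E} (hu : IsTestFunctionOffZero u)
    (hΩ : frontier Ω ⊆ {0}) : IsTestFunctionOffZero (Ω.indicator u) := by
  have hsupp : Function.support (Ω.indicator u) ⊆ Function.support u :=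
    support_indicator.trans_subset inter_subset_right
  refine ⟨contDiff_iff_contDiffAt.2 fun x => ?_, hu.2.1.mono hsupp,
    fun h => hu.2.2 (closure_mono hsupp h)⟩
  by_cases hx : x ∈ Ω
  · exact hu.1.contDiffAt.congr_of_eventuallyEq
      (indicator_eventuallyEq_self_of_mem hΩ hu.eventuallyEq_zero hx)
  · exact contDiffAt_const.congr_of_eventuallyEq
      (indicator_eventuallyEq_zero_of_notMem hΩ hu.eventuallyEq_zero hx)

end IsTestFunctionOffZero

end TestFunctions

section Hardy

variable {E : Type*} [NormedAddCommGroup E] [InnerProductSpace ℝ E]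

theorem fderiv_div_norm_pow_apply_self {f : E → ℝ} {x : E} (hf : DifferentiableAt ℝ f x)
    (hx : x ≠ 0) (n : ℕ) :
    fderiv ℝ (fun y => f y / ‖y‖ ^ n) x x = (fderiv ℝ f x x - n * f x) / ‖x‖ ^ n := by
  have hnorm : DifferentiableAt ℝ (fun y : E => ‖y‖) x :=
    (contDiffAt_norm ℝ hx).differentiableAt one_ne_zero
  have hx_norm : ‖x‖ ≠ 0 := norm_ne_zero_iff.2 hx
  have hpow : fderiv ℝ (fun y : E => ‖y‖ ^ n) x x = n * ‖x‖ ^ n := by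
    rw [fderiv_fun_pow n hnorm]
    rcases n with _ | n
    · simp
    · simp [hnorm.fderiv_norm_self, pow_succ, mul_assoc]
  have hinv := (hasDerivAt_inv (pow_ne_zero n hx_norm)).comp_hasFDerivAt x
    (hnorm.fun_pow n).hasFDerivAt
  have hmul := (hf.hasFDerivAt.fun_mul hinv).fderiv
  simp only [Function.comp_def] at hmul
  simp only [div_eq_mul_inv, hmul]
  simp only [neg_smul, smul_neg, add_apply, neg_apply, smul_apply, hpow, smul_eq_mul]
  field_simp
  ring

theorem norm_sq_apply_le_norm_sq_mul_sum {ι F : Type*} [Fintype ι] [NormedAddCommGroup F]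
    [NormedSpace ℝ F] (b : OrthonormalBasis ι ℝ E) (L : E →L[ℝ] F) (x : E) :
    ‖L x‖ ^ 2 ≤ ‖x‖ ^ 2 * ∑ i, ‖L (b i)‖ ^ 2 := by
  have h : ‖L x‖ ≤ ∑ i, |inner ℝ (b i) x| * ‖L (b i)‖ := by
    conv_lhs => rw [← b.sum_repr' x, map_sum]
    refine (norm_sum_le _ _).trans_eq (Finset.sum_congr rfl fun i _ => ?_)
    rw [map_smul, norm_smul, Real.norm_eq_abs]
  calc ‖L x‖ ^ 2 ≤ (∑ i, |inner ℝ (b i) x| * ‖L (b i)‖) ^ 2 := by gcongr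
    _ ≤ (∑ i, |inner ℝ (b i) x| ^ 2) * ∑ i, ‖L (b i)‖ ^ 2 := Finset.sum_mul_sq_le_sq_mul_sq _ _ _
    _ = ‖x‖ ^ 2 * ∑ i, ‖L (b i)‖ ^ 2 := by simp_rw [sq_abs, b.sum_sq_inner_right]

namespace IsTestFunctionOffZero

variable {u : E → ℂ}

theorem contDiff_norm_sq_div_norm_pow (hu : IsTestFunctionOffZero u) (n : ℕ) :
    ContDiff ℝ ∞ fun x => ‖u x‖ ^ 2 / ‖x‖ ^ n := by
  refine contDiff_iff_contDiffAt.2 fun x => ?_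
  rcases eq_or_ne x 0 with rfl | hx
  · refine (contDiffAt_const (c := (0 : ℝ))).congr_of_eventuallyEq ?_
    filter_upwards [hu.eventuallyEq_zero] with y hy
    simp [hy]
  · exact (hu.1.norm_sq ℝ).contDiffAt.div ((contDiffAt_norm ℝ hx).pow n) (by simp [hx])

theorem hasCompactSupport_norm_sq_div_norm_pow (hu : IsTestFunctionOffZero u) (n : ℕ) :
    HasCompactSupport fun x => ‖u x‖ ^ 2 / ‖x‖ ^ n :=
  hu.2.1.mono fun x hx hux => hx (by simp [hux])

theorem fderiv_norm_sq_div_norm_pow_apply_self (hu : IsTestFunctionOffZero u) (n : ℕ) (x : E) :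
    fderiv ℝ (fun y => ‖u y‖ ^ 2 / ‖y‖ ^ n) x x =
      2 * (inner ℝ (u x) (fderiv ℝ u x x) / ‖x‖ ^ n) - n * (‖u x‖ ^ 2 / ‖x‖ ^ n) := by
  rcases eq_or_ne x 0 with rfl | hx
  · simp [hu.apply_zero]
  have hu_diff : DifferentiableAt ℝ u x := hu.1.differentiable (by simp) x
  rw [fderiv_div_norm_pow_apply_self (hu_diff.norm_sq ℝ) hx, hu_diff.hasFDerivAt.norm_sq.fderiv]
  simp only [smul_apply, ContinuousLinearMap.comp_apply, coe_innerSL_apply, nsmul_eq_mul,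
    Nat.cast_ofNat]
  ring

variable [FiniteDimensional ℝ E] [MeasurableSpace E] [BorelSpace E]

theorem integrable_norm_sq_div_norm_pow (hu : IsTestFunctionOffZero u) (n : ℕ) :
    Integrable fun x => ‖u x‖ ^ 2 / ‖x‖ ^ n :=
  (hu.contDiff_norm_sq_div_norm_pow n).continuous.integrable_of_hasCompactSupport
    (hu.hasCompactSupport_norm_sq_div_norm_pow n)

theorem integrable_norm_sq (hu : IsTestFunctionOffZero u) : Integrable fun x => ‖u x‖ ^ 2 := by
  simpa using hu.integrable_norm_sq_div_norm_pow 0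

theorem integrable_inner_fderiv_apply_self_div_norm_pow (hu : IsTestFunctionOffZero u) (n : ℕ) :
    Integrable fun x => inner ℝ (u x) (fderiv ℝ u x x) / ‖x‖ ^ n := by
  have hrad : Integrable fun x => fderiv ℝ (fun y => ‖u y‖ ^ 2 / ‖y‖ ^ n) x x :=
    (((hu.contDiff_norm_sq_div_norm_pow n).continuous_fderiv (by simp)).clm_apply
      continuous_id).integrable_of_hasCompactSupport
      (((hu.hasCompactSupport_norm_sq_div_norm_pow n).fderiv (𝕜 := ℝ)).mono
        fun x hx h => hx (by simp [h]))
  refine ((hrad.add ((hu.integrable_norm_sq_div_norm_pow n).const_mul n)).const_mul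
    (1 / 2)).congr (.of_forall fun x => ?_)
  simp only [Pi.add_apply, hu.fderiv_norm_sq_div_norm_pow_apply_self]
  ring

theorem two_mul_integral_inner_fderiv_apply_self_div_norm_pow (hu : IsTestFunctionOffZero u)
    (n : ℕ) :
    2 * ∫ x, inner ℝ (u x) (fderiv ℝ u x x) / ‖x‖ ^ n =
      -((finrank ℝ E - n : ℝ) * ∫ x, ‖u x‖ ^ 2 / ‖x‖ ^ n) := by
  have h := integral_fderiv_apply_self volume
    ((hu.contDiff_norm_sq_div_norm_pow n).of_le (by simp))
    (hu.hasCompactSupport_norm_sq_div_norm_pow n)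
  simp_rw [hu.fderiv_norm_sq_div_norm_pow_apply_self] at h
  rw [integral_sub ((hu.integrable_inner_fderiv_apply_self_div_norm_pow n).const_mul 2)
    ((hu.integrable_norm_sq_div_norm_pow n).const_mul _), integral_const_mul, integral_const_mul,
    smul_eq_mul] at h
  linarith

theorem radial_hardy (hu : IsTestFunctionOffZero u) (n : ℕ) :
    (finrank ℝ E - n : ℝ) ^ 2 * ∫ x, ‖u x‖ ^ 2 / ‖x‖ ^ n ≤
      4 * ∫ x, ‖fderiv ℝ u x x‖ ^ 2 / ‖x‖ ^ n := by
  set m : ℝ := finrank ℝ E - n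
  have hu_int := (hu.integrable_norm_sq_div_norm_pow n).const_mul (m ^ 2)
  have hinner_int := (hu.integrable_inner_fderiv_apply_self_div_norm_pow n).const_mul (4 * m)
  have hrad_int : Integrable fun x => 4 * (‖fderiv ℝ u x x‖ ^ 2 / ‖x‖ ^ n) :=
    ((hu.fderiv_apply contDiff_id).integrable_norm_sq_div_norm_pow n).const_mul 4
  have hinner := hu.two_mul_integral_inner_fderiv_apply_self_div_norm_pow n
  have hsq : 0 ≤ m ^ 2 * (∫ x, ‖u x‖ ^ 2 / ‖x‖ ^ n) +
      4 * m * (∫ x, inner ℝ (u x) (fderiv ℝ u x x) / ‖x‖ ^ n) +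
      4 * ∫ x, ‖fderiv ℝ u x x‖ ^ 2 / ‖x‖ ^ n := calc
    0 ≤ ∫ x, ‖m • u x + (2 : ℝ) • fderiv ℝ u x x‖ ^ 2 / ‖x‖ ^ n :=
      integral_nonneg fun x => by positivity
    _ = ∫ x, (m ^ 2 * (‖u x‖ ^ 2 / ‖x‖ ^ n) +
          4 * m * (inner ℝ (u x) (fderiv ℝ u x x) / ‖x‖ ^ n) +
          4 * (‖fderiv ℝ u x x‖ ^ 2 / ‖x‖ ^ n)) := by
      congr 1 with x
      rw [norm_add_sq_real, real_inner_smul_left, real_inner_smul_right, norm_smul, norm_smul,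
        mul_pow, mul_pow, Real.norm_eq_abs, sq_abs, Real.norm_two]
      ring
    _ = _ := by
      rw [integral_add (hu_int.fun_add hinner_int) hrad_int, integral_add hu_int hinner_int,
        integral_const_mul, integral_const_mul, integral_const_mul]
  linear_combination hsq + 2 * m * hinner

theorem hardy {ι : Type*} [Fintype ι] (b : OrthonormalBasis ι ℝ E) (hu : IsTestFunctionOffZero u)
    (n : ℕ) :
    (finrank ℝ E - (n + 2) : ℝ) ^ 2 * ∫ x, ‖u x‖ ^ 2 / ‖x‖ ^ (n + 2) ≤
      4 * ∑ i, ∫ x, ‖fderiv ℝ u x (b i)‖ ^ 2 / ‖x‖ ^ n := by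
  have hgrad_int (i) : Integrable fun x => ‖fderiv ℝ u x (b i)‖ ^ 2 / ‖x‖ ^ n :=
    (hu.fderiv_apply contDiff_const).integrable_norm_sq_div_norm_pow n
  have hpointwise (x : E) : ‖fderiv ℝ u x x‖ ^ 2 / ‖x‖ ^ (n + 2) ≤
      ∑ i, ‖fderiv ℝ u x (b i)‖ ^ 2 / ‖x‖ ^ n := by
    rw [← Finset.sum_div]
    rcases eq_or_ne x 0 with rfl | hx
    · simpa using by positivity
    rw [div_le_div_iff₀ (by positivity) (by positivity)]
    calc _ ≤ (‖x‖ ^ 2 * ∑ i, ‖fderiv ℝ u x (b i)‖ ^ 2) * ‖x‖ ^ n := by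
          gcongr
          exact norm_sq_apply_le_norm_sq_mul_sum b _ x
      _ = _ := by ring
  calc (finrank ℝ E - (n + 2) : ℝ) ^ 2 * ∫ x, ‖u x‖ ^ 2 / ‖x‖ ^ (n + 2)
      ≤ 4 * ∫ x, ‖fderiv ℝ u x x‖ ^ 2 / ‖x‖ ^ (n + 2) := by
        exact_mod_cast hu.radial_hardy (n + 2)
    _ ≤ 4 * ∫ x, ∑ i, ‖fderiv ℝ u x (b i)‖ ^ 2 / ‖x‖ ^ n := by
        gcongr
        · exact (hu.fderiv_apply contDiff_id).integrable_norm_sq_div_norm_pow (n + 2)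
        · exact integrable_finsetSum _ fun i _ => hgrad_int i
        · exact hpointwise
    _ = 4 * ∑ i, ∫ x, ‖fderiv ℝ u x (b i)‖ ^ 2 / ‖x‖ ^ n := by
        rw [integral_finsetSum _ fun i _ => hgrad_int i]

end IsTestFunctionOffZero

end Hardy

section Rellich

open SchwartzMap
open scoped LineDeriv

variable {E : Type*} [NormedAddCommGroup E] [InnerProductSpace ℝ E] [FiniteDimensional ℝ E]

namespace IsTestFunctionOffZero

variable {u : E → ℂ}

theorem exists_schwartzMap (hu : IsTestFunctionOffZero u) :
    ∃ f : 𝓢(E, ℂ), ⇑f = u ∧ ⇑(Δ f : 𝓢(E, ℂ)) = Δ u := by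
  refine ⟨hu.2.1.toSchwartzMap hu.1, rfl, ?_⟩
  ext x
  rw [laplacian_apply]
  rfl

variable [MeasurableSpace E] [BorelSpace E]

theorem integrable_norm_sq_laplacian (hu : IsTestFunctionOffZero u) :
    Integrable fun x => ‖(Δ u) x‖ ^ 2 := by
  obtain ⟨f, rfl, hΔ⟩ := hu.exists_schwartzMap
  rw [← hΔ]
  exact integrable_norm_sq_schwartz volume _

theorem rellich (hu : IsTestFunctionOffZero u) :
    ((finrank ℝ E - 2) * (finrank ℝ E - 4) / 4 : ℝ) ^ 2 * ∫ x, ‖u x‖ ^ 2 / ‖x‖ ^ 4 ≤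
      ∫ x, ‖(Δ u) x‖ ^ 2 := by
  obtain ⟨f, rfl, hΔ⟩ := hu.exists_schwartzMap
  let b := stdOrthonormalBasis ℝ E
  have hardy_f : (finrank ℝ E - 4 : ℝ) ^ 2 * ∫ x, ‖f x‖ ^ 2 / ‖x‖ ^ 4 ≤
      4 * ∑ i, ∫ x, ‖fderiv ℝ f x (b i)‖ ^ 2 / ‖x‖ ^ 2 := by
    have h := hu.hardy b 2
    rwa [Nat.cast_ofNat, two_add_two_eq_four] at h
  have hardy_grad : (finrank ℝ E - 2 : ℝ) ^ 2 * ∑ i, ∫ x, ‖fderiv ℝ f x (b i)‖ ^ 2 / ‖x‖ ^ 2 ≤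
      4 * ∫ x, ‖(Δ (f : E → ℂ)) x‖ ^ 2 := by
    rw [← hΔ, ← sum_integral_norm_sq_lineDeriv_lineDeriv b f, Finset.mul_sum, Finset.mul_sum]
    refine Finset.sum_le_sum fun i _ => ?_
    have h := (hu.fderiv_apply (contDiff_const (c := b i))).hardy b 0
    simp only [Nat.cast_zero, zero_add, pow_zero, div_one] at h
    exact h
  linear_combination (1 / 16 * (finrank ℝ E - 2 : ℝ) ^ 2) * hardy_f + 1 / 4 * hardy_grad

end IsTestFunctionOffZero

variable [MeasurableSpace E] [BorelSpace E]

theorem exists_mul_integral_laplacian_le {D₁ : ℝ}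
    (hD₁ : D₁ < ((finrank ℝ E - 2) * (finrank ℝ E - 4) / 4) ^ 2) :
    ∃ ε : ℝ, 0 < ε ∧ ∀ u : E → ℂ, IsTestFunctionOffZero u →
      ε * ∫ x, ‖(Δ u) x‖ ^ 2 ≤ (∫ x, ‖(Δ u) x‖ ^ 2) - D₁ * ∫ x, ‖u x‖ ^ 2 / ‖x‖ ^ 4 := by
  set R : ℝ := ((finrank ℝ E - 2) * (finrank ℝ E - 4) / 4) ^ 2
  have htendsto : Tendsto (fun ε : ℝ => (1 - ε) * R) (𝓝[>] 0) (𝓝 R) := by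
    have h : Continuous fun ε : ℝ => (1 - ε) * R := by fun_prop
    simpa using (h.tendsto 0).mono_left nhdsWithin_le_nhds
  obtain ⟨ε, hD₁_lt, hε_pos, hε_lt_one⟩ :=
    ((htendsto.eventually_const_lt hD₁).and (Ioo_mem_nhdsGT one_pos)).exists
  refine ⟨ε, hε_pos, fun u hu => ?_⟩
  have : 0 ≤ ∫ x, ‖u x‖ ^ 2 / ‖x‖ ^ 4 := integral_nonneg fun x => by positivity
  have h : D₁ * ∫ x, ‖u x‖ ^ 2 / ‖x‖ ^ 4 ≤ (1 - ε) * ∫ x, ‖(Δ u) x‖ ^ 2 := calc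
    D₁ * ∫ x, ‖u x‖ ^ 2 / ‖x‖ ^ 4 ≤ (1 - ε) * (R * ∫ x, ‖u x‖ ^ 2 / ‖x‖ ^ 4) := by
      rw [← mul_assoc]
      gcongr
    _ ≤ (1 - ε) * ∫ x, ‖(Δ u) x‖ ^ 2 :=
      mul_le_mul_of_nonneg_left hu.rellich (sub_nonneg.2 hε_lt_one.le)
  linarith

theorem exists_eLpNorm_le_integral_laplacian (hE : finrank ℝ E < 4) {D₁ : ℝ}
    (hD₁ : D₁ < ((finrank ℝ E - 2) * (finrank ℝ E - 4) / 4) ^ 2) :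
    ∃ D₂ : ℝ, 0 < D₂ ∧ ∀ p : ℝ≥0∞, 1 ≤ p → ∀ u : E → ℂ, IsTestFunctionOffZero u →
      eLpNorm (fun x => ‖u x‖ ^ 2) p ≤ ENNReal.ofReal (∫ x,
        (‖(Δ u) x‖ ^ 2 - D₁ * (‖u x‖ ^ 2 / ‖x‖ ^ 4) + D₂ * ‖u x‖ ^ 2)) := by
  obtain ⟨ε, hε, hε_le⟩ := exists_mul_integral_laplacian_le hD₁
  obtain ⟨C, hC, hC_le⟩ := exists_norm_sq_le_integral_laplacian (F := ℂ) hE hε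
  refine ⟨C + 1, by positivity, fun p hp u hu => ?_⟩
  have hsup (x : E) : ‖u x‖ ^ 2 ≤ ε * (∫ y, ‖(Δ u) y‖ ^ 2) + C * ∫ y, ‖u y‖ ^ 2 := by
    obtain ⟨f, rfl, hΔ⟩ := hu.exists_schwartzMap
    simpa only [hΔ] using hC_le f x
  have hu_nonneg : 0 ≤ ∫ x, ‖u x‖ ^ 2 := integral_nonneg fun x => sq_nonneg _
  have hΔ_nonneg : 0 ≤ ∫ x, ‖(Δ u) x‖ ^ 2 := integral_nonneg fun x => sq_nonneg _
  have hrhs : ε * (∫ x, ‖(Δ u) x‖ ^ 2) + (C + 1) * (∫ x, ‖u x‖ ^ 2) ≤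
      ∫ x, (‖(Δ u) x‖ ^ 2 - D₁ * (‖u x‖ ^ 2 / ‖x‖ ^ 4) + (C + 1) * ‖u x‖ ^ 2) := by
    have hu_int := hu.integrable_norm_sq.const_mul (C + 1)
    have hu_div_int := (hu.integrable_norm_sq_div_norm_pow 4).const_mul D₁
    have hΔ_int : Integrable fun x => ‖(Δ u) x‖ ^ 2 := hu.integrable_norm_sq_laplacian
    have hdiff_int : Integrable fun x => ‖(Δ u) x‖ ^ 2 - D₁ * (‖u x‖ ^ 2 / ‖x‖ ^ 4) :=
      hΔ_int.sub hu_div_int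
    rw [integral_add hdiff_int hu_int, integral_sub hΔ_int hu_div_int,
      integral_const_mul, integral_const_mul]
    gcongr
    exact hε_le u hu
  refine eLpNorm_le_of_enorm_le_of_lintegral_enorm_le hp (.of_forall fun x => ?_) ?_
  · rw [Real.enorm_of_nonneg (sq_nonneg _)]
    exact ENNReal.ofReal_le_ofReal (by linarith [hsup x])
  · rw [← ofReal_integral_norm_eq_lintegral_enorm hu.integrable_norm_sq]
    simp only [norm_pow, norm_norm]
    exact ENNReal.ofReal_le_ofReal
      (by linarith [mul_nonneg hε.le hΔ_nonneg, mul_nonneg hC.le hu_nonneg])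

end Rellich

section Domains

variable {E : Type*} [NormedAddCommGroup E] [InnerProductSpace ℝ E] [FiniteDimensional ℝ E]
  {Ω : Set E} {u : E → ℂ}

theorem IsTestFunctionOffZero.laplacian_indicator (hu : IsTestFunctionOffZero u)
    (hΩ : frontier Ω ⊆ {0}) : Δ (Ω.indicator u) = Ω.indicator (Δ u) := by
  ext x
  by_cases hx : x ∈ Ω
  · rw [indicator_of_mem hx]
    exact (InnerProductSpace.laplacian_congr_nhds
      (indicator_eventuallyEq_self_of_mem hΩ hu.eventuallyEq_zero hx)).self_of_nhds
  · rw [indicator_of_notMem hx, (InnerProductSpace.laplacian_congr_nhds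
      (indicator_eventuallyEq_zero_of_notMem hΩ hu.eventuallyEq_zero hx)).self_of_nhds]
    exact congrFun (InnerProductSpace.laplacian_const (c := (0 : ℂ))) x

theorem mainTheorem4_general [MeasurableSpace E] [BorelSpace E] (hE : finrank ℝ E < 4) {D₁ : ℝ}
    (hD₁ : D₁ < ((finrank ℝ E - 2) * (finrank ℝ E - 4) / 4) ^ 2) :
    ∃ D₂ : ℝ, 0 < D₂ ∧ ∀ p : ℝ≥0∞, 1 ≤ p → ∀ Ω : Set E, frontier Ω ⊆ {0} →
      ∀ u : E → ℂ, IsTestFunctionOffZero u →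
        eLpNorm (fun x => ‖u x‖ ^ 2) p (volume.restrict Ω) ≤ ENNReal.ofReal (∫ x in Ω,
          (‖(Δ u) x‖ ^ 2 - D₁ * (‖u x‖ ^ 2 / ‖x‖ ^ 4) + D₂ * ‖u x‖ ^ 2)) := by
  obtain ⟨D₂, hD₂, H⟩ := exists_eLpNorm_le_integral_laplacian hE hD₁
  refine ⟨D₂, hD₂, fun p hp Ω hΩ u hu => ?_⟩
  have hΩ_meas := measurableSet_of_countable_frontier ((countable_singleton 0).mono hΩ)
  have hlhs : (Ω.indicator fun x => ‖u x‖ ^ 2) = fun x => ‖Ω.indicator u x‖ ^ 2 := by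
    ext x
    by_cases hx : x ∈ Ω <;> simp [hx]
  have hrhs : (Ω.indicator fun x =>
      ‖(Δ u) x‖ ^ 2 - D₁ * (‖u x‖ ^ 2 / ‖x‖ ^ 4) + D₂ * ‖u x‖ ^ 2) =
      fun x => ‖(Δ (Ω.indicator u)) x‖ ^ 2 - D₁ * (‖Ω.indicator u x‖ ^ 2 / ‖x‖ ^ 4) +
        D₂ * ‖Ω.indicator u x‖ ^ 2 := by
    ext x
    by_cases hx : x ∈ Ω <;> simp [hu.laplacian_indicator hΩ, hx]
  rw [← eLpNorm_indicator_eq_eLpNorm_restrict hΩ_meas, ← integral_indicator hΩ_meas, hlhs, hrhs]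
  exact H p hp _ (hu.indicator hΩ)

end Domains

/- For `1 < p < ∞`, `eLpNorm (fun x => ‖u x‖ ^ 2) p` is `(∫ |u|^(2p))^(1/p)`; for `p = ∞` it is the
essential supremum of `|u|²`. It is an extended non-negative real, so its being at most
`ENNReal.ofReal` of the right-hand side includes its finiteness. -/
theorem mainTheorem4 (p : ℝ≥0∞) (hp : 1 < p) :
    -- dimension one, on the half-line and on the whole line
    (∃ D₁ D₂ : ℝ, 0 < D₁ ∧ 0 < D₂ ∧
      ∀ u : ℝ → ℂ, IsTestFunctionOffZero u →
        eLpNorm (fun x => ‖u x‖ ^ 2) p (volume.restrict (Ioi (0 : ℝ))) ≤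
          ENNReal.ofReal (∫ x in Ioi (0 : ℝ),
            (‖deriv (deriv u) x‖ ^ 2 - D₁ * (‖u x‖ ^ 2 / x ^ 4) + D₂ * ‖u x‖ ^ 2)) ∧
        eLpNorm (fun x => ‖u x‖ ^ 2) p volume ≤
          ENNReal.ofReal (∫ x : ℝ,
            (‖deriv (deriv u) x‖ ^ 2 - D₁ * (‖u x‖ ^ 2 / x ^ 4) + D₂ * ‖u x‖ ^ 2))) ∧
    -- dimension three
    (∃ D₁ D₂ : ℝ, 0 < D₁ ∧ 0 < D₂ ∧
      ∀ u : EuclideanSpace ℝ (Fin 3) → ℂ, IsTestFunctionOffZero u →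
        eLpNorm (fun x => ‖u x‖ ^ 2) p volume ≤
          ENNReal.ofReal (∫ x : EuclideanSpace ℝ (Fin 3),
            (‖(Δ u) x‖ ^ 2 - D₁ * (‖u x‖ ^ 2 / ‖x‖ ^ 4) + D₂ * ‖u x‖ ^ 2))) := by
  constructor
  · obtain ⟨D₂, hD₂, H⟩ := mainTheorem4_general (E := ℝ) (D₁ := 1 / 2) (by simp) (by norm_num)
    simp only [InnerProductSpace.laplacian_eq_iteratedDeriv_real, iteratedDeriv_succ,
      iteratedDeriv_zero, Real.norm_eq_abs, Even.pow_abs (n := 4) (by decide)] at H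
    exact ⟨1 / 2, D₂, by norm_num, hD₂, fun u hu => ⟨H p hp.le _ frontier_Ioi.subset u hu,
      by simpa using H p hp.le univ (by simp) u hu⟩⟩
  · obtain ⟨D₂, hD₂, H⟩ := mainTheorem4_general (E := EuclideanSpace ℝ (Fin 3)) (D₁ := 1 / 32)
      (by simp) (by norm_num)
    exact ⟨1 / 32, D₂, by norm_num, hD₂, fun u hu => by
      simpa using H p hp.le univ (by simp) u hu⟩
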